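/- Let $(X,d)$ be a complete separable metric space with its Borel $\sigma$-algebra, and let $m=(m_x)_{x\in X}$ be a random walk on $X$: a family of Borel probability measures on $X$, depending measurably on $x$, each with finite first moment ($\int d(o,y)\,dm_x(y)<\infty$ for some, hence any, $o\in X$). Let $\mathcal P(X)$ be the set of Borel probability measures on $X$ with finite first moment, let $\mathcal T_1(\mu,\mu')=\inf_\xi\int d(x,y)\,d\xi(x,y)$, the infimum being over all measures $\xi$ on $X\times X$ with marginals $\mu$ and $\mu'$, and for $x\neq y$ put $\kappa(x,y)=1-\mathcal T_1(m_x,m_y)/d(x,y)$. For a probability measure $\mu$ put $\mu*m=\int d\mu(x)\,m_x$; let $m_x^{*n}$ be the law after $n$ steps of the walk started at $x$, let $\mu*m^{*n}=\int d\mu(x)\,m_x^{*n}$, and let $J(x)=\int d(x,y)\,dm_x(y)$. Let $\kappa\in\mathbb R$. (1) One has $\kappa(x,y)\ge\kappa$ for all distinct $x,y\in X$ if and only if for all $\mu,\mu'\in\mathcal P(X)$ $$\mathcal T_1(\mu*m,\mu'*m)\le(1-\kappa)\,\mathcal T_1(\mu,\mu')$$ (in particular the left-hand side is finite). Moreover,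 in this case, $\mu*m\in\mathcal P(X)$ for every $\mu\in\mathcal P(X)$. (2) Suppose that $X$ is non-empty and that $\kappa(x,y)\ge\kappa>0$ for all distinct $x,y\in X$. Then there is exactly one probability measure $\nu$ on $X$ with $\nu*m=\nu$, and $\nu\in\mathcal P(X)$. Moreover, for all $\mu\in\mathcal P(X)$ and all integers $n\ge0$, $$\mathcal T_1(\mu*m^{*n},\nu)\le(1-\kappa)^n\,\mathcal T_1(\mu,\nu),$$ and in particular, for all $x\in X$ and $n\ge0$, $$\mathcal T_1(m_x^{*n},\nu)\le(1-\kappa)^n\,\frac{J(x)}{\kappa}.$$ -/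

import Mathlib

open MeasureTheory ProbabilityTheory
open scoped ENNReal

namespace RicciWalk

section Defs

variable {X : Type*} [MetricSpace X] [MeasurableSpace X]

/-- The set `𝒫(X)`: probability measures with finite first moment, i.e. for some (hence any)
origin `o` the integral of `d(o, ·)` is finite. -/
def MemP (μ : Measure X) : Prop :=
  IsProbabilityMeasure μ ∧ ∃ o : X, ∫⁻ x, edist o x ∂μ < ∞

/-- A random walk on `X`: a measurable family `x ↦ m x` of probability measures on `X` (a
`Kernel` is such a measurable family of measures), each with finite first moment. -/
def IsRandomWalk (m : Kernel X X) : Prop :=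
  ∀ x : X, MemP (m x)

/-- The couplings of `μ` and `μ'`: measures on `X × X` projecting to `μ` and `μ'`. -/
def couplings (μ μ' : Measure X) : Set (Measure (X × X)) :=
  {ξ | ξ.map Prod.fst = μ ∧ ξ.map Prod.snd = μ'}

/-- The `L¹` transportation distance, with values in `[0, ∞]`. -/
noncomputable def T1 (μ μ' : Measure X) : ℝ≥0∞ :=
  ⨅ ξ ∈ couplings μ μ', ∫⁻ p, edist p.1 p.2 ∂ξ

/-- The coarse Ricci curvature of the random walk `m` along the pair of distinct points `x, y`.
(The transportation distance is finite, as `m x` and `m y` have finite first moment.) -/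
noncomputable def ricci (m : Kernel X X) (x y : X) : ℝ :=
  1 - (T1 (m x) (m y)).toReal / dist x y

/-- The Ricci curvature of the random walk `m` is at least `κ`. -/
def RicciGE (m : Kernel X X) (κ : ℝ) : Prop :=
  ∀ x y : X, x ≠ y → κ ≤ ricci m x y

/-- The image `μ * m` of the measure `μ` by `m`, i.e. `∫ dμ(x) m x`. -/
noncomputable def conv (μ : Measure X) (m : Kernel X X) : Measure X :=
  μ.bind m

/-- The jump at `x`: the expectation of `d(x, ·)` under `m x`. -/
noncomputable def jump (m : Kernel X X) (x : X) : ℝ :=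
  ∫ y, dist x y ∂(m x)

/-- `ν` is an invariant distribution of the random walk `m`: a probability measure with
`ν * m = ν`. -/
def IsInvariantDistribution (m : Kernel X X) (ν : Measure X) : Prop :=
  IsProbabilityMeasure ν ∧ m.Invariant ν

end Defs

end RicciWalk

/-! ### Transportation distance: couplings, gluing, test functions, first moments. -/

namespace RicciWalk

section Transport

open scoped NNReal Topology
open Filter

variable {X : Type*} [MetricSpace X] [MeasurableSpace X]

/-! Curvature at least `κ` says that `x ↦ m x` is `(1 - κ)`-Lipschitz from `X` to `T1`; Dirac masses
embed `X` isometrically (`T1_dirac`), so contraction on measures implies the curvature bound. For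
the converse one would couple `μ` and `μ'`, then couple `m x` with `m y` for each pair `(x, y)`,
which requires a measurable choice of couplings. This choice is avoided: for points with values in a
countable set any choice is measurable (`T1_conv_map_le_of_countable`), and general points are
approximated by such ones. That the discretized images converge to `conv μ m` in `T1`
(`tendsto_T1_conv_map`) follows from completeness of the transportation distance
(`exists_T1_le_tsum`), the limit being identified by integrals of Lipschitz functions
(`ext_of_lipschitz`). The outcome is `T1_conv_le`.

If `κ > 0`, the iterates of a Dirac mass form a sequence with summable steps, and their limit is
invariant (`exists_invariant`). Uniqueness among all probability measures, where `T1` may be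
infinite, comes from bounded Lipschitz test functions and dominated convergence (`eq_of_invariant`).
-/

lemma T1_le {μ μ' : Measure X} {ξ : Measure (X × X)} (h₁ : ξ.map Prod.fst = μ)
    (h₂ : ξ.map Prod.snd = μ') : T1 μ μ' ≤ ∫⁻ p, edist p.1 p.2 ∂ξ :=
  iInf₂_le ξ ⟨h₁, h₂⟩

lemma exists_coupling_lt {μ μ' : Measure X} {c : ℝ≥0∞} (h : T1 μ μ' < c) :
    ∃ ξ ∈ couplings μ μ', ∫⁻ p, edist p.1 p.2 ∂ξ < c := by
  simpa [T1, iInf_lt_iff] using h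

omit [MetricSpace X] in
lemma isProbabilityMeasure_of_mem_couplings {μ μ' : Measure X} [IsProbabilityMeasure μ]
    {ξ : Measure (X × X)} (h : ξ ∈ couplings μ μ') : IsProbabilityMeasure ξ := by
  have h1 : IsProbabilityMeasure (ξ.map Prod.fst) := by rw [h.1]; infer_instance
  exact (Measure.isProbabilityMeasure_map_iff measurable_fst.aemeasurable).1 h1

/-- An affine bound against the cost of every coupling is one against the transportation
distance. -/
lemma le_add_mul_T1 {μ μ' : Measure X} (hT : T1 μ μ' ≠ ∞) {a b : ℝ≥0∞} {L : ℝ≥0}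
    (h : ∀ ξ ∈ couplings μ μ', a ≤ b + L * ∫⁻ p, edist p.1 p.2 ∂ξ) : a ≤ b + L * T1 μ μ' := by
  refine ENNReal.le_of_forall_pos_le_add fun ε hε _ ↦ ?_
  obtain ⟨δ, hδ, hδε⟩ : ∃ δ : ℝ≥0, 0 < δ ∧ L * δ ≤ ε := by
    -- Dividing by `L + 1` rather than `L` covers `L = 0`.
    refine ⟨ε / (L + 1), by positivity, ?_⟩
    rw [mul_div_assoc', div_le_iff₀ (by positivity)]
    nlinarith [mul_comm L ε, zero_le (a := ε)]
  obtain ⟨ξ, hξ, hlt⟩ := exists_coupling_lt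
    (ENNReal.lt_add_right hT (by simpa using hδ.ne' : (δ : ℝ≥0∞) ≠ 0))
  calc a ≤ b + L * ∫⁻ p, edist p.1 p.2 ∂ξ := h ξ hξ
    _ ≤ b + L * (T1 μ μ' + δ) := by gcongr
    _ ≤ b + L * T1 μ μ' + ε := by
      rw [mul_add, ← add_assoc]
      gcongr
      exact_mod_cast hδε

variable [BorelSpace X] [SecondCountableTopology X]

/-- Two random points on one space are a coupling of their laws; most upper bounds on `T1` below
arise this way. -/
lemma T1_map_le {Ω : Type*} [MeasurableSpace Ω] (P : Measure Ω) {f g : Ω → X}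
    (hf : Measurable f) (hg : Measurable g) :
    T1 (P.map f) (P.map g) ≤ ∫⁻ ω, edist (f ω) (g ω) ∂P := by
  refine (T1_le (ξ := P.map fun ω ↦ (f ω, g ω)) ?_ ?_).trans_eq ?_
  · rw [Measure.map_map measurable_fst (hf.prodMk hg)]; rfl
  · rw [Measure.map_map measurable_snd (hf.prodMk hg)]; rfl
  · rw [lintegral_map measurable_edist (hf.prodMk hg)]

lemma T1_self (μ : Measure X) : T1 μ μ = 0 := by
  simpa using T1_map_le μ measurable_id measurable_id

lemma T1_comm (μ μ' : Measure X) : T1 μ μ' = T1 μ' μ := by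
  have key : ∀ μ μ' : Measure X, T1 μ μ' ≤ T1 μ' μ := by
    intro μ μ'
    refine le_iInf₂ fun ξ hξ ↦ ?_
    have h := T1_map_le ξ measurable_snd measurable_fst
    rw [hξ.1, hξ.2] at h
    simpa only [edist_comm] using h
  exact le_antisymm (key _ _) (key _ _)

/-- The easy half of Kantorovich duality: integrate the Lipschitz bound against a coupling. -/
lemma lintegral_le_add_T1 {f : X → ℝ≥0∞} (hf : Measurable f) {L : ℝ≥0}
    (hL : ∀ x y, f x ≤ f y + L * edist x y) {μ μ' : Measure X} (hT : T1 μ μ' ≠ ∞) :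
    ∫⁻ x, f x ∂μ ≤ ∫⁻ x, f x ∂μ' + L * T1 μ μ' := by
  refine le_add_mul_T1 hT fun ξ hξ ↦ ?_
  calc ∫⁻ x, f x ∂μ = ∫⁻ p, f p.1 ∂ξ := by rw [← hξ.1, lintegral_map hf measurable_fst]
    _ ≤ ∫⁻ p, (f p.2 + L * edist p.1 p.2) ∂ξ := lintegral_mono fun p ↦ hL _ _
    _ = ∫⁻ x, f x ∂μ' + L * ∫⁻ p, edist p.1 p.2 ∂ξ := by
      rw [lintegral_add_left (f := fun p : X × X ↦ f p.2) (hf.comp measurable_snd),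
        lintegral_const_mul _ measurable_edist, ← hξ.2, lintegral_map hf measurable_snd]

omit [SecondCountableTopology X] in
/-- Finite measures are determined by their integrals against Lipschitz functions with values in
`[0, 1]`. -/
lemma ext_of_lipschitz {μ ν : Measure X} [IsFiniteMeasure μ] [IsFiniteMeasure ν]
    (h : ∀ (f : X → ℝ≥0∞) (L : ℝ≥0), Measurable f → (∀ x, f x ≤ 1) →
      (∀ x y, f x ≤ f y + L * edist x y) → ∫⁻ x, f x ∂μ = ∫⁻ x, f x ∂ν) : μ = ν := by
  have key : ∀ F : Set X, IsClosed F → μ F = ν F := by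
    intro F hF
    have hpos : ∀ n : ℕ, (0 : ℝ) < 1 / (n + 1) := fun n ↦ Nat.one_div_pos_of_nat
    have h₁ := tendsto_lintegral_thickenedIndicator_of_isClosed μ hF hpos
      tendsto_one_div_add_atTop_nhds_zero_nat
    have h₂ := tendsto_lintegral_thickenedIndicator_of_isClosed ν hF hpos
      tendsto_one_div_add_atTop_nhds_zero_nat
    -- The indicator thickened by `δ` is `δ⁻¹`-Lipschitz, which makes it an admissible test
    -- function.
    refine tendsto_nhds_unique h₁
      (h₂.congr fun n ↦ (h _ ((1 / (n + 1) : ℝ).toNNReal⁻¹) ?_ ?_ ?_).symm)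
    · exact (thickenedIndicator (hpos n) F).continuous.measurable.coe_nnreal_ennreal
    · exact fun x ↦ by exact_mod_cast thickenedIndicator_le_one (hpos n) F x
    · intro x y
      have := lipschitzWith_thickenedIndicator (hpos n) F x y
      refine le_trans ?_ (add_le_add_right this _)
      rw [edist_nndist, ← ENNReal.coe_add, ENNReal.coe_le_coe, ← NNReal.coe_le_coe, NNReal.coe_add,
        coe_nndist, NNReal.dist_eq]
      linarith [le_abs_self
        ((thickenedIndicator (hpos n) F x : ℝ) - thickenedIndicator (hpos n) F y)]
  refine ext_of_generate_finite _ ?_ isPiSystem_isClosed key (key _ isClosed_univ)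
  rw [BorelSpace.measurable_eq (α := X), borel_eq_generateFrom_isClosed]

lemma eq_of_T1_eq_zero {μ ν : Measure X} [IsFiniteMeasure μ] [IsFiniteMeasure ν]
    (h : T1 μ ν = 0) : μ = ν := by
  refine ext_of_lipschitz fun f L hf _ hL ↦ le_antisymm ?_ ?_
  · simpa [h] using lintegral_le_add_T1 hf hL (μ := μ) (μ' := ν) (by simp [h])
  · rw [T1_comm] at h
    simpa [h] using lintegral_le_add_T1 hf hL (μ := ν) (μ' := μ) (by simp [h])

omit [MetricSpace X] [BorelSpace X] [SecondCountableTopology X] in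
lemma map_compProd_comap {α β γ : Type*} [MeasurableSpace α] [MeasurableSpace β]
    [MeasurableSpace γ] (μ : Measure α) [SFinite μ] (K : Kernel β γ) [IsSFiniteKernel K]
    {f : α → β} (hf : Measurable f) :
    (μ ⊗ₘ K.comap f hf).map (Prod.map f id) = μ.map f ⊗ₘ K := by
  ext s hs
  have hm : Measurable (Prod.map f (id : γ → γ)) := hf.prodMap measurable_id
  rw [Measure.map_apply hm hs, Measure.compProd_apply (hm hs), Measure.compProd_apply hs,
    lintegral_map (Kernel.measurable_kernel_prodMk_left hs) hf]
  rfl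

/-- Gluing: draw a pair from `ξ`, then a third point from the conditional law of `η` given the
middle one. Completeness and separability make `X` standard Borel, so `η` disintegrates. -/
lemma T1_triangle [CompleteSpace X] (μ₁ μ₂ μ₃ : Measure X) [IsProbabilityMeasure μ₁]
    [IsProbabilityMeasure μ₂] : T1 μ₁ μ₃ ≤ T1 μ₁ μ₂ + T1 μ₂ μ₃ := by
  have : Nonempty X := nonempty_of_isProbabilityMeasure μ₁
  rw [T1.eq_1 μ₁ μ₂, T1.eq_1 μ₂]
  refine ENNReal.le_iInf₂_add_iInf₂ fun ξ hξ η hη ↦ ?_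
  have := isProbabilityMeasure_of_mem_couplings hξ
  have := isProbabilityMeasure_of_mem_couplings hη
  have hη' : η.fst ⊗ₘ η.condKernel = η := η.disintegrate _
  set P := ξ ⊗ₘ η.condKernel.comap Prod.snd measurable_snd with hP
  have hP₁ : P.map Prod.fst = ξ := Measure.fst_compProd ξ _
  have hP₂ : P.map (Prod.map Prod.snd id) = η := by
    rw [hP, map_compProd_comap, hξ.2, ← hη.1]
    exact hη'
  have h := T1_map_le P (f := fun p ↦ p.1.1) (g := Prod.snd) (by fun_prop) (by fun_prop)
  have e₁ : P.map (fun p ↦ p.1.1) = μ₁ := by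
    rw [← hξ.1, ← hP₁, Measure.map_map measurable_fst measurable_fst]
    rfl
  have e₂ : P.map Prod.snd = μ₃ := by
    rw [← hη.2, ← hP₂, Measure.map_map measurable_snd (measurable_snd.prodMap measurable_id)]
    rfl
  rw [e₁, e₂] at h
  refine h.trans ?_
  calc ∫⁻ p, edist p.1.1 p.2 ∂P ≤ ∫⁻ p, (edist p.1.1 p.1.2 + edist p.1.2 p.2) ∂P :=
        lintegral_mono fun p ↦ edist_triangle _ _ _
    _ = ∫⁻ p, edist p.1.1 p.1.2 ∂P + ∫⁻ p, edist p.1.2 p.2 ∂P :=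
        lintegral_add_left (measurable_edist.comp measurable_fst) _
    _ = ∫⁻ p, edist p.1 p.2 ∂ξ + ∫⁻ p, edist p.1 p.2 ∂η := by
        conv_rhs => rw [← hP₁, ← hP₂]
        rw [lintegral_map measurable_edist measurable_fst,
          lintegral_map measurable_edist (measurable_snd.prodMap measurable_id)]
        rfl

lemma T1_dirac (x y : X) : T1 (Measure.dirac x) (Measure.dirac y) = edist x y := by
  refine le_antisymm ?_ (le_iInf₂ fun ξ hξ ↦ ?_)
  · refine (T1_le (ξ := Measure.dirac (x, y)) ?_ ?_).trans_eq ?_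
    · rw [Measure.map_dirac']
      exact measurable_fst
    · rw [Measure.map_dirac']
      exact measurable_snd
    · rw [lintegral_dirac]
  · have := isProbabilityMeasure_of_mem_couplings hξ
    have h₁ : ∀ᵐ p ∂ξ, p.1 = x := by
      refine ae_of_ae_map (p := fun z ↦ z = x) measurable_fst.aemeasurable ?_
      rw [hξ.1, ae_dirac_eq]
      rfl
    have h₂ : ∀ᵐ p ∂ξ, p.2 = y := by
      refine ae_of_ae_map (p := fun z ↦ z = y) measurable_snd.aemeasurable ?_
      rw [hξ.2, ae_dirac_eq]
      rfl
    have : ∫⁻ p, edist p.1 p.2 ∂ξ = ∫⁻ _, edist x y ∂ξ := by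
      refine lintegral_congr_ae ?_
      filter_upwards [h₁, h₂] with p hp₁ hp₂
      rw [hp₁, hp₂]
    simp [this]

omit [BorelSpace X] [SecondCountableTopology X] in
lemma MemP.lintegral_edist_lt_top {μ : Measure X} (hμ : MemP μ) (o : X) :
    ∫⁻ x, edist o x ∂μ < ∞ := by
  obtain ⟨_, o', ho'⟩ := hμ
  calc ∫⁻ x, edist o x ∂μ ≤ ∫⁻ x, (edist o o' + edist o' x) ∂μ :=
        lintegral_mono fun x ↦ edist_triangle _ _ _
    _ = edist o o' + ∫⁻ x, edist o' x ∂μ := by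
        rw [lintegral_add_left measurable_const]
        simp
    _ < ∞ := ENNReal.add_lt_top.2 ⟨edist_lt_top _ _, ho'⟩

/-- The product coupling has finite cost. -/
lemma T1_ne_top {μ μ' : Measure X} (hμ : MemP μ) (hμ' : MemP μ') : T1 μ μ' ≠ ∞ := by
  have := hμ.1
  have := hμ'.1
  obtain ⟨o, ho⟩ := hμ.2
  refine ((T1_le (ξ := μ.prod μ') (by simp) (by simp)).trans_lt ?_).ne
  calc ∫⁻ p, edist p.1 p.2 ∂(μ.prod μ') ≤ ∫⁻ p, (edist o p.1 + edist o p.2) ∂(μ.prod μ') :=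
        lintegral_mono fun p ↦ edist_triangle_left _ _ _
    _ = ∫⁻ x, edist o x ∂μ + ∫⁻ x, edist o x ∂μ' := by
        rw [lintegral_add_left (measurable_const.edist measurable_fst)]
        congr 1
        · rw [← lintegral_map (f := fun x ↦ edist o x) (measurable_const.edist measurable_id)
            measurable_fst]
          simp
        · rw [← lintegral_map (f := fun x ↦ edist o x) (measurable_const.edist measurable_id)
            measurable_snd]
          simp
    _ < ∞ := ENNReal.add_lt_top.2 ⟨ho, hμ'.lintegral_edist_lt_top o⟩

lemma T1_dirac_left_le (x : X) (μ : Measure X) [IsProbabilityMeasure μ] :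
    T1 (Measure.dirac x) μ ≤ ∫⁻ y, edist x y ∂μ := by
  simpa using T1_map_le μ (f := fun _ ↦ x) (g := id) measurable_const measurable_id

lemma memP_dirac (x : X) : MemP (Measure.dirac x) :=
  ⟨inferInstance, x, by simp⟩

omit [MeasurableSpace X] [BorelSpace X] [SecondCountableTopology X] in
lemma edist_le_edist_add_mul (o x y : X) : edist o x ≤ edist o y + (1 : ℝ≥0) * edist x y := by
  simpa [edist_comm x y] using edist_triangle o y x

lemma MemP.of_T1_ne_top {μ μ' : Measure X} [IsProbabilityMeasure μ] (hμ' : MemP μ')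
    (h : T1 μ μ' ≠ ∞) : MemP μ := by
  obtain ⟨o, ho⟩ := hμ'.2
  refine ⟨inferInstance, o, (lintegral_le_add_T1 (measurable_const.edist measurable_id)
    (edist_le_edist_add_mul o) h).trans_lt ?_⟩
  simpa [lt_top_iff_ne_top, h] using ho.ne

end Transport
end RicciWalk

/-! ### Completeness of the transportation distance. -/

namespace RicciWalk

section Completeness

open scoped NNReal Topology
open Filter

/-- Consecutive couplings are glued into the law of one random sequence. -/
lemma exists_measure_map_eq {Y : Type*} [MeasurableSpace Y] [StandardBorelSpace Y]
    {μ : ℕ → Measure Y} [∀ n, IsProbabilityMeasure (μ n)] {ξ : ℕ → Measure (Y × Y)}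
    (h₁ : ∀ n, (ξ n).map Prod.fst = μ n) (h₂ : ∀ n, (ξ n).map Prod.snd = μ (n + 1)) :
    ∃ P : Measure (ℕ → Y), IsProbabilityMeasure P ∧
      ∀ n, P.map (fun x ↦ (x n, x (n + 1))) = ξ n := by
  have : Nonempty Y := nonempty_of_isProbabilityMeasure (μ 0)
  have hξ : ∀ n, IsProbabilityMeasure (ξ n) := fun n ↦ by
    have h : IsProbabilityMeasure ((ξ n).map Prod.fst) := by rw [h₁]; infer_instance
    exact (Measure.isProbabilityMeasure_map_iff measurable_fst.aemeasurable).1 h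
  let last (n : ℕ) : (Finset.Iic n → Y) → Y := fun x ↦ x ⟨n, Finset.mem_Iic.2 le_rfl⟩
  have hlast : ∀ n, Measurable (last n) := fun n ↦ measurable_pi_apply _
  -- The sequence is a Markov chain: the next point depends on the past only through its last entry,
  -- with the conditional law given by `ξ n`.
  let K (n : ℕ) : Kernel (Finset.Iic n → Y) Y := (ξ n).condKernel.comap (last n) (hlast n)
  let P : Measure (ℕ → Y) := Kernel.trajMeasure (X := fun _ ↦ Y) (μ 0) K
  have hP : IsProbabilityMeasure P := inferInstance
  have hstep : ∀ n, P.map (fun x ↦ x n) = μ n → P.map (fun x ↦ (x n, x (n + 1))) = ξ n := by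
    intro n hn
    have h := Kernel.map_frestrictLe_trajMeasure_compProd_eq_map_trajMeasure
      (X := fun _ ↦ Y) (μ₀ := μ 0) (κ := K) (a := n)
    have h' := congrArg (Measure.map (Prod.map (last n) id)) h
    have hfr : Measurable (Preorder.frestrictLe (π := fun _ : ℕ ↦ Y) n) := by fun_prop
    rw [map_compProd_comap, Measure.map_map (hlast n) hfr,
      Measure.map_map ((hlast n).prodMap measurable_id)
        (hfr.prodMk (measurable_pi_apply _))] at h'
    refine h'.symm.trans ?_
    have : P.map (last n ∘ Preorder.frestrictLe (π := fun _ : ℕ ↦ Y) n) = (ξ n).fst :=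
      hn.trans (h₁ n).symm
    rw [this]
    exact (ξ n).disintegrate _
  have h0 : P.map (fun x ↦ x 0) = μ 0 := by
    have : P.map (fun x ↦ x 0) = (P.map (Preorder.frestrictLe (π := fun _ : ℕ ↦ Y) 0)).map
        (last 0) := by
      rw [Measure.map_map (hlast 0) (by fun_prop)]
      rfl
    rw [this]
    simp only [P, Kernel.trajMeasure]
    rw [Measure.map_comp _ _ (by fun_prop), Kernel.traj_map_frestrictLe, Kernel.partialTraj_self,
      Measure.id_comp, Measure.map_map (hlast 0) (by fun_prop)]
    exact Measure.map_id
  have hmarg : ∀ n, P.map (fun x ↦ x n) = μ n := by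
    intro n
    induction n with
    | zero => exact h0
    | succ n ih =>
      rw [← h₂ n, ← hstep n ih, Measure.map_map measurable_snd (by fun_prop)]
      rfl
  exact ⟨P, hP, fun n ↦ hstep n (hmarg n)⟩

variable {X : Type*} [MetricSpace X] [CompleteSpace X] [SecondCountableTopology X]
  [MeasurableSpace X] [BorelSpace X]

/-- Completeness of the transportation distance: a sequence with summable steps converges. -/
lemma exists_T1_le_tsum {μ : ℕ → Measure X} [∀ n, IsProbabilityMeasure (μ n)] {c : ℕ → ℝ≥0∞}
    (hc : ∑' n, c n ≠ ∞) (h : ∀ n, T1 (μ n) (μ (n + 1)) < c n) :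
    ∃ ν : Measure X, IsProbabilityMeasure ν ∧ ∀ n, T1 (μ n) ν ≤ ∑' k, c (n + k) := by
  have : Nonempty X := nonempty_of_isProbabilityMeasure (μ 0)
  choose ξ hξ hξc using fun n ↦ exists_coupling_lt (h n)
  obtain ⟨P, hP, hPξ⟩ := exists_measure_map_eq (fun n ↦ (hξ n).1) (fun n ↦ (hξ n).2)
  have hpair : ∀ n, Measurable fun x : ℕ → X ↦ (x n, x (n + 1)) := fun n ↦ by fun_prop
  have hmarg : ∀ n, P.map (fun x ↦ x n) = μ n := fun n ↦ by
    rw [← (hξ n).1, ← hPξ n, Measure.map_map measurable_fst (hpair n)]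
    rfl
  have hcost : ∀ n, ∫⁻ x, edist (x n) (x (n + 1)) ∂P ≤ c n := fun n ↦ by
    have := (hξc n).le
    rwa [← hPξ n, lintegral_map measurable_edist (hpair n)] at this
  have hmeas : ∀ n, Measurable fun x : ℕ → X ↦ edist (x n) (x (n + 1)) := fun n ↦
    measurable_edist.comp (hpair n)
  -- The expected total length of the random path is at most `∑' n, c n`, so almost every path is
  -- Cauchy; the law of its endpoint `Z` is the limit.
  have hsum : ∀ᵐ x ∂P, ∑' n, edist (x n) (x (n + 1)) < ∞ := by
    refine ae_lt_top (Measurable.tsum hmeas) ?_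
    rw [lintegral_tsum fun n ↦ (hmeas n).aemeasurable]
    exact ((ENNReal.tsum_le_tsum hcost).trans_lt hc.lt_top).ne
  have hlim : ∀ᵐ x ∂P, ∃ l, Tendsto (fun n ↦ x n) atTop (𝓝 l) := by
    filter_upwards [hsum] with x hx
    exact cauchySeq_tendsto_of_complete
      (cauchySeq_of_edist_le_of_tsum_ne_top _ (fun n ↦ le_rfl) hx.ne)
  obtain ⟨Z, hZ, hZlim⟩ := measurable_limit_of_tendsto_metrizable_ae
    (fun n ↦ (measurable_pi_apply n : Measurable fun x : ℕ → X ↦ x n).aemeasurable) hlim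
  refine ⟨P.map Z, Measure.isProbabilityMeasure_map hZ.aemeasurable, fun n ↦ ?_⟩
  rw [← hmarg n]
  refine (T1_map_le P (measurable_pi_apply n) hZ).trans ?_
  calc ∫⁻ x, edist (x n) (Z x) ∂P
      ≤ ∫⁻ x, ∑' k, edist (x (n + k)) (x (n + k + 1)) ∂P := by
        refine lintegral_mono_ae ?_
        filter_upwards [hZlim] with x hx
        exact edist_le_tsum_of_edist_le_of_tendsto _ (fun n ↦ le_rfl) hx n
    _ = ∑' k, ∫⁻ x, edist (x (n + k)) (x (n + k + 1)) ∂P :=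
        lintegral_tsum fun k ↦ (hmeas (n + k)).aemeasurable
    _ ≤ ∑' k, c (n + k) := ENNReal.tsum_le_tsum fun k ↦ hcost _

end Completeness
end RicciWalk

/-! ### Contraction of `T1` under one step of the walk. -/

namespace RicciWalk

section Contraction

open scoped NNReal Topology
open Filter

variable {X : Type*} [MetricSpace X] [SecondCountableTopology X]
  [MeasurableSpace X] [BorelSpace X]

omit [SecondCountableTopology X] [MeasurableSpace X] [BorelSpace X] in
lemma continuous_of_le_add_mul_edist {f : X → ℝ≥0∞} {L : ℝ≥0}
    (hL : ∀ x y, f x ≤ f y + L * edist x y) : Continuous f :=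
  continuous_of_le_add_edist (L : ℝ≥0∞) ENNReal.coe_ne_top hL

omit [MetricSpace X] [SecondCountableTopology X] [BorelSpace X] in
lemma lintegral_ne_top_of_le_one {f : X → ℝ≥0∞} (hf : ∀ x, f x ≤ 1) (μ : Measure X)
    [IsProbabilityMeasure μ] : ∫⁻ x, f x ∂μ ≠ ∞ :=
  ((lintegral_mono hf).trans_lt (by simp)).ne

lemma tendsto_lintegral_of_tendsto_T1 {ι : Type*} {l : Filter ι} {μ : ι → Measure X}
    {ν : Measure X} [IsProbabilityMeasure ν] (h : Tendsto (fun n ↦ T1 (μ n) ν) l (𝓝 0))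
    {f : X → ℝ≥0∞} (hf : Measurable f) (hf1 : ∀ x, f x ≤ 1) {L : ℝ≥0}
    (hL : ∀ x y, f x ≤ f y + L * edist x y) :
    Tendsto (fun n ↦ ∫⁻ x, f x ∂(μ n)) l (𝓝 (∫⁻ x, f x ∂ν)) := by
  have hfin : ∀ᶠ n in l, T1 (μ n) ν ≠ ∞ :=
    (h.eventually (gt_mem_nhds ENNReal.zero_lt_top)).mono fun n hn ↦ hn.ne
  have hLT : Tendsto (fun n ↦ L * T1 (μ n) ν) l (𝓝 0) := by
    simpa using ENNReal.Tendsto.const_mul h (Or.inr ENNReal.coe_ne_top)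
  have hlow : Tendsto (fun n ↦ ∫⁻ x, f x ∂ν - L * T1 (μ n) ν) l (𝓝 (∫⁻ x, f x ∂ν)) := by
    simpa using ENNReal.Tendsto.sub (tendsto_const_nhds (x := ∫⁻ x, f x ∂ν)) hLT
      (Or.inl (lintegral_ne_top_of_le_one hf1 ν))
  have hup : Tendsto (fun n ↦ ∫⁻ x, f x ∂ν + L * T1 (μ n) ν) l (𝓝 (∫⁻ x, f x ∂ν)) := by
    simpa using (tendsto_const_nhds (x := ∫⁻ x, f x ∂ν)).add hLT
  refine tendsto_of_tendsto_of_tendsto_of_le_of_le' hlow hup ?_ ?_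
  · filter_upwards [hfin] with n hn
    rw [tsub_le_iff_right]
    rw [T1_comm] at hn ⊢
    exact lintegral_le_add_T1 hf hL hn
  · filter_upwards [hfin] with n hn
    exact lintegral_le_add_T1 hf hL hn

lemma T1_bind_le {Ω : Type*} [MeasurableSpace Ω] (P : Measure Ω) {A B : Ω → Measure X}
    (Q : Kernel Ω (X × X)) (hQ : ∀ ω, Q ω ∈ couplings (A ω) (B ω)) :
    T1 (P.bind A) (P.bind B) ≤ ∫⁻ ω, ∫⁻ p, edist p.1 p.2 ∂(Q ω) ∂P := by
  refine (T1_le (ξ := P.bind Q) ?_ ?_).trans_eq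
    (Measure.lintegral_bind Q.aemeasurable measurable_edist.aemeasurable)
  · rw [Measure.map_comp _ _ measurable_fst]
    refine Measure.bind_congr_right (.of_forall fun ω ↦ ?_)
    rw [Kernel.map_apply _ measurable_fst, (hQ ω).1]
  · rw [Measure.map_comp _ _ measurable_snd]
    refine Measure.bind_congr_right (.of_forall fun ω ↦ ?_)
    rw [Kernel.map_apply _ measurable_snd, (hQ ω).2]

omit [MetricSpace X] [SecondCountableTopology X] [BorelSpace X] in
lemma conv_map {Ω : Type*} [MeasurableSpace Ω] (P : Measure Ω) {f : Ω → X} (hf : Measurable f)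
    (m : Kernel X X) : conv (P.map f) m = P.bind fun ω ↦ m (f ω) := by
  ext s hs
  rw [conv, Measure.bind_apply hs m.aemeasurable,
    Measure.bind_apply (f := fun ω ↦ m (f ω)) hs (m.measurable.comp hf).aemeasurable,
    lintegral_map (m.measurable_coe hs) hf]

variable {m : Kernel X X} {C : ℝ≥0}

/-- The contraction estimate for random points with values in a countable set. -/
lemma T1_conv_map_le_of_countable (hC : ∀ x y, T1 (m x) (m y) ≤ C * edist x y) {Ω : Type*}
    [MeasurableSpace Ω] (P : Measure Ω) [IsProbabilityMeasure P] (u : ℕ → X) {i j : Ω → ℕ}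
    (hi : Measurable i) (hj : Measurable j) :
    T1 (conv (P.map fun ω ↦ u (i ω)) m) (conv (P.map fun ω ↦ u (j ω)) m) ≤
      C * ∫⁻ ω, edist (u (i ω)) (u (j ω)) ∂P := by
  have hu : Measurable u := measurable_of_countable u
  have hm : Measurable fun ω ↦ edist (u (i ω)) (u (j ω)) :=
    (hu.comp hi).edist (hu.comp hj)
  refine ENNReal.le_of_forall_pos_le_add fun ε hε _ ↦ ?_
  have hlt : ∀ a : ℕ × ℕ, T1 (m (u a.1)) (m (u a.2)) < C * edist (u a.1) (u a.2) + ε := by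
    intro a
    refine (hC _ _).trans_lt (ENNReal.lt_add_right ?_ (by simpa using hε.ne'))
    exact ENNReal.mul_ne_top ENNReal.coe_ne_top (edist_ne_top _ _)
  choose ξ hξ hξc using fun a ↦ exists_coupling_lt (hlt a)
  -- The chosen couplings are indexed by the countable set `ℕ × ℕ`, hence depend measurably on the
  -- index.
  let Q : Kernel Ω (X × X) := (Kernel.ofFunOfCountable ξ).comap (fun ω ↦ (i ω, j ω)) (hi.prodMk hj)
  rw [conv_map P (f := fun ω ↦ u (i ω)) (hu.comp hi) m,
    conv_map P (f := fun ω ↦ u (j ω)) (hu.comp hj) m]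
  refine (T1_bind_le P Q fun ω ↦ hξ (i ω, j ω)).trans ?_
  calc ∫⁻ ω, ∫⁻ p, edist p.1 p.2 ∂(Q ω) ∂P
      ≤ ∫⁻ ω, (C * edist (u (i ω)) (u (j ω)) + ε) ∂P :=
        lintegral_mono fun ω ↦ (hξc (i ω, j ω)).le
    _ = C * ∫⁻ ω, edist (u (i ω)) (u (j ω)) ∂P + ε := by
        rw [lintegral_add_right _ measurable_const, lintegral_const_mul _ hm]
        simp

/-- Uniform approximation of the identity by measurable maps with countable range. -/
lemma exists_measurable_index [Nonempty X] {ε : ℝ≥0∞} (hε : 0 < ε) :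
    ∃ i : X → ℕ, Measurable i ∧ ∀ x, edist (TopologicalSpace.denseSeq X (i x)) x ≤ ε := by
  classical
  have hex : ∀ x : X, ∃ k, edist (TopologicalSpace.denseSeq X k) x < ε := fun x ↦ by
    obtain ⟨_, ⟨k, rfl⟩, hk⟩ := EMetric.mem_closure_iff.1
      (TopologicalSpace.denseRange_denseSeq X x) ε hε
    exact ⟨k, by rwa [edist_comm]⟩
  exact ⟨fun x ↦ Nat.find (hex x), measurable_find hex fun k ↦
    measurableSet_lt (measurable_const.edist measurable_id) measurable_const,
    fun x ↦ (Nat.find_spec (hex x)).le⟩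

lemma le_add_mul_edist_of_T1_le (hC : ∀ x y, T1 (m x) (m y) ≤ C * edist x y) {f : X → ℝ≥0∞}
    (hf : Measurable f) {L : ℝ≥0} (hL : ∀ x y, f x ≤ f y + L * edist x y) (x y : X) :
    ∫⁻ z, f z ∂(m x) ≤ ∫⁻ z, f z ∂(m y) + ((L * C : ℝ≥0) : ℝ≥0∞) * edist x y := by
  have hT : T1 (m x) (m y) ≠ ∞ :=
    ((hC x y).trans_lt (ENNReal.mul_lt_top ENNReal.coe_lt_top (edist_lt_top _ _))).ne
  refine (lintegral_le_add_T1 hf hL hT).trans ?_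
  rw [ENNReal.coe_mul, mul_assoc]
  gcongr
  exact hC x y

omit [MetricSpace X] [SecondCountableTopology X] [BorelSpace X] in
lemma lintegral_conv (μ : Measure X) {f : X → ℝ≥0∞} (hf : Measurable f) :
    ∫⁻ x, f x ∂(conv μ m) = ∫⁻ x, ∫⁻ y, f y ∂(m x) ∂μ :=
  Measure.lintegral_bind m.aemeasurable hf.aemeasurable

omit [MetricSpace X] [SecondCountableTopology X] [BorelSpace X] in
instance conv.instIsProbabilityMeasure [IsMarkovKernel m] (μ : Measure X) [IsProbabilityMeasure μ] :
    IsProbabilityMeasure (conv μ m) := by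
  unfold conv
  infer_instance

variable [CompleteSpace X]

/-- The discretized images cannot yet be compared directly with `conv μ m`, but consecutive ones can
be compared with each other. They therefore converge to some `ν`, and Lipschitz test functions show
that `ν = conv μ m`. -/
lemma tendsto_T1_conv_map [Nonempty X] [IsMarkovKernel m]
    (hC : ∀ x y, T1 (m x) (m y) ≤ C * edist x y)
    (μ : Measure X) [IsProbabilityMeasure μ] {i : ℕ → X → ℕ} (hi : ∀ n, Measurable (i n))
    (hiε : ∀ n x, edist (TopologicalSpace.denseSeq X (i n x)) x ≤ 2⁻¹ ^ n) :
    Tendsto (fun n ↦ T1 (conv (μ.map fun x ↦ TopologicalSpace.denseSeq X (i n x)) m) (conv μ m))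
      atTop (𝓝 0) := by
  set u := TopologicalSpace.denseSeq X
  have hφ : ∀ n, Measurable fun x ↦ u (i n x) := fun n ↦ (measurable_of_countable u).comp (hi n)
  have hprob : ∀ n, IsProbabilityMeasure (μ.map fun x ↦ u (i n x)) :=
    fun n ↦ Measure.isProbabilityMeasure_map (hφ n).aemeasurable
  have hgeo : ∑' n : ℕ, (2⁻¹ : ℝ≥0∞) ^ n ≠ ∞ := by
    rw [ENNReal.tsum_geometric]
    simp
  have hstep : ∀ n, T1 (conv (μ.map fun x ↦ u (i n x)) m) (conv (μ.map fun x ↦ u (i (n + 1) x)) m)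
      -- The extra `1` makes the inequality strict, as `exists_T1_le_tsum` requires.
      < (C * 2 + 1) * 2⁻¹ ^ n := by
    intro n
    have hpow : (2⁻¹ : ℝ≥0∞) ^ (n + 1) ≤ 2⁻¹ ^ n :=
      pow_le_pow_right_of_le_one' (by simp) n.le_succ
    have htop : (2⁻¹ : ℝ≥0∞) ^ n ≠ ∞ := ENNReal.pow_ne_top (by simp)
    calc _ ≤ C * ∫⁻ x, edist (u (i n x)) (u (i (n + 1) x)) ∂μ :=
          T1_conv_map_le_of_countable hC μ u (hi n) (hi (n + 1))
      _ ≤ C * ∫⁻ _, 2⁻¹ ^ n + 2⁻¹ ^ n ∂μ := by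
          gcongr with x
          exact (edist_triangle_right _ _ x).trans
            (add_le_add (hiε n x) ((hiε (n + 1) x).trans hpow))
      _ = C * 2 * 2⁻¹ ^ n := by simp [mul_assoc, two_mul]
      _ < (C * 2 + 1) * 2⁻¹ ^ n := by
          rw [add_mul, one_mul]
          refine ENNReal.lt_add_right (by finiteness) (by simp)
  have hsum : ∑' n : ℕ, ((C * 2 + 1) * 2⁻¹ ^ n : ℝ≥0∞) ≠ ∞ := by
    rw [ENNReal.tsum_mul_left]
    exact ENNReal.mul_ne_top (by finiteness) hgeo
  obtain ⟨ν, hν, hle⟩ := exists_T1_le_tsum hsum hstep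
  have hlim : Tendsto (fun n ↦ T1 (conv (μ.map fun x ↦ u (i n x)) m) ν) atTop (𝓝 0) := by
    refine tendsto_of_tendsto_of_tendsto_of_le_of_le tendsto_const_nhds
      (ENNReal.tendsto_sum_nat_add _ hsum) (fun _ ↦ zero_le) fun n ↦ ?_
    simpa only [add_comm] using hle n
  suffices ν = conv μ m by rwa [this] at hlim
  refine ext_of_lipschitz fun f L hf hf1 hL ↦ ?_
  refine tendsto_nhds_unique (tendsto_lintegral_of_tendsto_T1 hlim hf hf1 hL) ?_
  have hg : Measurable fun x ↦ ∫⁻ y, f y ∂(m x) := hf.lintegral_kernel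
  have hgc : Continuous fun x ↦ ∫⁻ y, f y ∂(m x) :=
    continuous_of_le_add_mul_edist (le_add_mul_edist_of_T1_le hC hf hL)
  rw [lintegral_conv μ hf]
  simp_rw [lintegral_conv _ hf, lintegral_map hg (hφ _)]
  refine tendsto_lintegral_of_dominated_convergence (fun _ ↦ 1) (fun n ↦ hg.comp (hφ n))
    (fun n ↦ .of_forall fun x ↦ (lintegral_mono hf1).trans (by simp)) (by simp)
    (.of_forall fun x ↦ (hgc.tendsto x).comp ?_)
  rw [tendsto_iff_edist_tendsto_0]
  exact tendsto_of_tendsto_of_tendsto_of_le_of_le tendsto_const_nhds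
    (ENNReal.tendsto_pow_atTop_nhds_zero_of_lt_one (by simp)) (fun _ ↦ zero_le) fun n ↦ hiε n x

/-- The contraction property of the convolution. -/
lemma T1_conv_le [IsMarkovKernel m] (hC : ∀ x y, T1 (m x) (m y) ≤ C * edist x y)
    {μ μ' : Measure X} [IsProbabilityMeasure μ] [IsProbabilityMeasure μ'] (hT : T1 μ μ' ≠ ∞) :
    T1 (conv μ m) (conv μ' m) ≤ C * T1 μ μ' := by
  have : Nonempty X := nonempty_of_isProbabilityMeasure μ
  have hpos : ∀ n : ℕ, (0 : ℝ≥0∞) < 2⁻¹ ^ n := fun n ↦ ENNReal.pow_pos (by simp) n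
  choose i hi hiε using fun n ↦ exists_measurable_index (X := X) (hpos n)
  set u := TopologicalSpace.denseSeq X with hu
  have hφ : ∀ n, Measurable fun x ↦ u (i n x) := fun n ↦ (measurable_of_countable u).comp (hi n)
  have hprob : ∀ (μ : Measure X) [IsProbabilityMeasure μ] (n : ℕ),
      IsProbabilityMeasure (μ.map fun x ↦ u (i n x)) :=
    fun μ _ n ↦ Measure.isProbabilityMeasure_map (hφ n).aemeasurable
  have key : ∀ ξ ∈ couplings μ μ',
      T1 (conv μ m) (conv μ' m) ≤ 0 + C * ∫⁻ p, edist p.1 p.2 ∂ξ := by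
    intro ξ hξ
    have := isProbabilityMeasure_of_mem_couplings hξ
    -- With `ξ` itself as probability space, rounding both coordinates costs at most `2⁻¹ ^ n` each.
    have hdisc : ∀ n, T1 (conv (μ.map fun x ↦ u (i n x)) m) (conv (μ'.map fun x ↦ u (i n x)) m)
        ≤ C * (∫⁻ p, edist p.1 p.2 ∂ξ + 2 * 2⁻¹ ^ n) := by
      intro n
      rw [← hξ.1, ← hξ.2, Measure.map_map (hφ n) measurable_fst,
        Measure.map_map (hφ n) measurable_snd]
      refine (T1_conv_map_le_of_countable hC ξ u ((hi n).comp measurable_fst)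
        ((hi n).comp measurable_snd)).trans ?_
      gcongr
      calc ∫⁻ p, edist (u (i n p.1)) (u (i n p.2)) ∂ξ
          ≤ ∫⁻ p, (edist p.1 p.2 + 2 * 2⁻¹ ^ n) ∂ξ := by
            refine lintegral_mono fun p ↦ ?_
            calc edist (u (i n p.1)) (u (i n p.2))
                ≤ edist (u (i n p.1)) p.1 + edist p.1 p.2 + edist p.2 (u (i n p.2)) :=
                  edist_triangle4 _ _ _ _
              _ ≤ 2⁻¹ ^ n + edist p.1 p.2 + 2⁻¹ ^ n := by
                  gcongr
                  · exact hiε n _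
                  · rw [edist_comm]
                    exact hiε n _
              _ = edist p.1 p.2 + 2 * 2⁻¹ ^ n := by ring
        _ = ∫⁻ p, edist p.1 p.2 ∂ξ + 2 * 2⁻¹ ^ n := by
            rw [lintegral_add_right _ measurable_const]
            simp
    have hbound : ∀ n, T1 (conv μ m) (conv μ' m) ≤
        T1 (conv (μ.map fun x ↦ u (i n x)) m) (conv μ m) +
          (C * (∫⁻ p, edist p.1 p.2 ∂ξ + 2 * 2⁻¹ ^ n) +
          T1 (conv (μ'.map fun x ↦ u (i n x)) m) (conv μ' m)) := by
      intro n
      have := hprob μ n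
      have := hprob μ' n
      refine (T1_triangle _ (conv (μ.map fun x ↦ u (i n x)) m) _).trans ?_
      rw [T1_comm (conv μ m)]
      gcongr
      refine (T1_triangle _ (conv (μ'.map fun x ↦ u (i n x)) m) _).trans ?_
      gcongr
      exact hdisc n
    have hp : Tendsto (fun n : ℕ ↦ (2 : ℝ≥0∞) * 2⁻¹ ^ n) atTop (𝓝 0) := by
      simpa using ENNReal.Tendsto.const_mul (a := 2)
        (ENNReal.tendsto_pow_atTop_nhds_zero_of_lt_one (r := 2⁻¹) (by simp)) (by simp)
    have hlim := (tendsto_T1_conv_map hC μ hi hiε).add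
      ((ENNReal.Tendsto.const_mul (a := (C : ℝ≥0∞))
        ((tendsto_const_nhds (x := ∫⁻ p, edist p.1 p.2 ∂ξ)).add hp)
        (Or.inr ENNReal.coe_ne_top)).add (tendsto_T1_conv_map hC μ' hi hiε))
    simpa using ge_of_tendsto' hlim hbound
  simpa using le_add_mul_T1 hT key

/-- Finiteness of first moments is preserved. -/
lemma MemP.conv [IsMarkovKernel m] (hm : IsRandomWalk m)
    (hC : ∀ x y, T1 (m x) (m y) ≤ C * edist x y) {μ : Measure X} (hμ : MemP μ) :
    MemP (conv μ m) := by
  have := hμ.1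
  obtain ⟨o, ho⟩ := hμ.2
  have h : T1 (RicciWalk.conv μ m) (m o) ≠ ∞ := by
    have e : RicciWalk.conv (Measure.dirac o) m = m o := Measure.dirac_bind m.measurable o
    rw [← e]
    have hT := T1_ne_top hμ (memP_dirac o)
    exact ((T1_conv_le hC hT).trans_lt (ENNReal.mul_lt_top ENNReal.coe_lt_top hT.lt_top)).ne
  exact (hm o).of_T1_ne_top h

end Contraction
end RicciWalk

/-! ### Iterates, the invariant distribution and its uniqueness. -/

namespace RicciWalk

section Invariant

open scoped NNReal Topology
open Filter

variable {X : Type*} [MetricSpace X] [MeasurableSpace X] {m : Kernel X X} {κ : ℝ} {C : ℝ≥0}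

lemma IsRandomWalk.isMarkovKernel (hm : IsRandomWalk m) : IsMarkovKernel m :=
  ⟨fun x ↦ (hm x).1⟩

omit [MetricSpace X] in
lemma conv_pow_succ (μ : Measure X) (n : ℕ) : conv μ (m ^ (n + 1)) = conv (conv μ (m ^ n)) m := by
  rw [pow_succ']
  exact Measure.comp_assoc.symm

omit [MetricSpace X] in
lemma conv_conv_pow (μ : Measure X) (n : ℕ) : conv (conv μ m) (m ^ n) = conv μ (m ^ (n + 1)) := by
  rw [pow_succ]
  exact Measure.comp_assoc

omit [MetricSpace X] in
lemma conv_pow_zero (μ : Measure X) : conv μ (m ^ 0) = μ := Measure.id_comp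

omit [MetricSpace X] in
lemma conv_dirac (x : X) : conv (Measure.dirac x) m = m x := Measure.dirac_bind m.measurable x

omit [MetricSpace X] in
lemma conv_pow_of_invariant {ν : Measure X} (h : conv ν m = ν) (n : ℕ) : conv ν (m ^ n) = ν := by
  induction n with
  | zero => exact conv_pow_zero ν
  | succ n ih => rw [conv_pow_succ, ih, h]

/-- Curvature never exceeds `1`. This disposes of `κ > 1`, where `1 - κ` is negative and its
truncation by `Real.toNNReal` is `0`. -/
lemma RicciGE.subsingleton (h : RicciGE m κ) (hκ : 1 < κ) : Subsingleton X := by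
  refine ⟨fun x y ↦ by_contra fun hxy ↦ ?_⟩
  have h₁ : κ ≤ 1 - (T1 (m x) (m y)).toReal / dist x y := h x y hxy
  have h₂ : 0 ≤ (T1 (m x) (m y)).toReal / dist x y := by positivity
  linarith

lemma T1_eq_zero_of_subsingleton [Subsingleton X] (μ μ' : Measure X) [IsProbabilityMeasure μ]
    [IsProbabilityMeasure μ'] : T1 μ μ' = 0 := by
  refine le_antisymm ((T1_le (ξ := μ.prod μ') (by simp) (by simp)).trans_eq ?_) zero_le
  have h0 : ∀ p : X × X, edist p.1 p.2 = 0 := fun p ↦ by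
    rw [Subsingleton.elim p.1 p.2, edist_self]
  simp [h0]

variable [BorelSpace X] [SecondCountableTopology X]

lemma RicciGE.T1_le (hm : IsRandomWalk m) (h : RicciGE m κ) (x y : X) :
    T1 (m x) (m y) ≤ (1 - κ).toNNReal * edist x y := by
  rcases eq_or_ne x y with rfl | hxy
  · simp [T1_self]
  have h₁ : κ ≤ 1 - (T1 (m x) (m y)).toReal / dist x y := h x y hxy
  have hd : 0 < dist x y := dist_pos.2 hxy
  have h₂ : (T1 (m x) (m y)).toReal ≤ (1 - κ) * dist x y := by
    rw [← div_le_iff₀ hd]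
    linarith
  rw [← ENNReal.ofReal_toReal (T1_ne_top (hm x) (hm y)), edist_dist]
  exact (ENNReal.ofReal_le_ofReal h₂).trans_eq (ENNReal.ofReal_mul' hd.le)

lemma ricciGE_of_T1_conv_le (h : ∀ μ μ' : Measure X, MemP μ → MemP μ' →
    (T1 (conv μ m) (conv μ' m)).toReal ≤ (1 - κ) * (T1 μ μ').toReal) : RicciGE m κ := by
  intro x y hxy
  have := h _ _ (memP_dirac x) (memP_dirac y)
  rw [conv_dirac, conv_dirac, T1_dirac, ← dist_edist, ← div_le_iff₀ (dist_pos.2 hxy)] at this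
  rw [ricci]
  linarith

lemma RicciGE.toReal_T1_le (h : RicciGE m κ) {μ μ' : Measure X} (hμ : MemP μ) (hμ' : MemP μ')
    {n : ℕ} {t : ℝ≥0∞} (ht : t ≤ (1 - κ).toNNReal ^ n * T1 μ μ') :
    t ≠ ∞ ∧ t.toReal ≤ (1 - κ) ^ n * (T1 μ μ').toReal := by
  have := hμ.1
  have := hμ'.1
  have hfin : ((1 - κ).toNNReal : ℝ≥0∞) ^ n * T1 μ μ' ≠ ∞ :=
    ENNReal.mul_ne_top (by finiteness) (T1_ne_top hμ hμ')
  refine ⟨ne_top_of_le_ne_top hfin ht, (ENNReal.toReal_mono hfin ht).trans ?_⟩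
  rcases le_or_gt κ 1 with hκ | hκ
  · simp [hκ]
  · have := h.subsingleton hκ
    simp [T1_eq_zero_of_subsingleton μ μ']

variable [CompleteSpace X]

lemma MemP.conv_pow (hm : IsRandomWalk m) (hC : ∀ x y, T1 (m x) (m y) ≤ C * edist x y)
    {μ : Measure X} (hμ : MemP μ) (n : ℕ) : MemP (RicciWalk.conv μ (m ^ n)) := by
  have := hm.isMarkovKernel
  induction n with
  | zero => rwa [conv_pow_zero]
  | succ n ih =>
    rw [conv_pow_succ]
    exact ih.conv hm hC

lemma T1_conv_pow_le (hm : IsRandomWalk m) (hC : ∀ x y, T1 (m x) (m y) ≤ C * edist x y)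
    {μ μ' : Measure X} (hμ : MemP μ) (hμ' : MemP μ') (n : ℕ) :
    T1 (conv μ (m ^ n)) (conv μ' (m ^ n)) ≤ C ^ n * T1 μ μ' := by
  have := hm.isMarkovKernel
  induction n with
  | zero => rw [conv_pow_zero, conv_pow_zero, pow_zero, one_mul]
  | succ n ih =>
    have h₁ := hμ.conv_pow hm hC n
    have h₂ := hμ'.conv_pow hm hC n
    have := h₁.1
    have := h₂.1
    rw [conv_pow_succ, conv_pow_succ, pow_succ', mul_assoc]
    exact (T1_conv_le hC (T1_ne_top h₁ h₂)).trans (by gcongr)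

lemma exists_invariant [Nonempty X] (hm : IsRandomWalk m)
    (hC : ∀ x y, T1 (m x) (m y) ≤ C * edist x y) (hC1 : C < 1) :
    ∃ ν : Measure X, MemP ν ∧ conv ν m = ν := by
  have := hm.isMarkovKernel
  obtain ⟨o⟩ := ‹Nonempty X›
  have ho := memP_dirac o
  have hμ : ∀ n, MemP (conv (Measure.dirac o) (m ^ n)) := ho.conv_pow hm hC
  set μ : ℕ → Measure X := fun n ↦ conv (Measure.dirac o) (m ^ n) with hμdef
  have hprob : ∀ n, IsProbabilityMeasure (μ n) := fun n ↦ (hμ n).1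
  set T := T1 (Measure.dirac o) (conv (Measure.dirac o) m)
  have hT : T ≠ ∞ := T1_ne_top ho (ho.conv hm hC)
  -- The summable term `2⁻¹ ^ n` only serves to make the bound strict.
  have hstep : ∀ n, T1 (μ n) (μ (n + 1)) < C ^ n * T + 2⁻¹ ^ n := by
    intro n
    have h := T1_conv_pow_le hm hC ho (ho.conv hm hC) n
    rw [conv_conv_pow] at h
    exact h.trans_lt (ENNReal.lt_add_right (by finiteness) (by simp))
  have hsum : ∑' n : ℕ, ((C : ℝ≥0∞) ^ n * T + 2⁻¹ ^ n) ≠ ∞ := by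
    rw [ENNReal.tsum_add, ENNReal.tsum_mul_right, ENNReal.tsum_geometric, ENNReal.tsum_geometric]
    have : (1 : ℝ≥0∞) - C ≠ 0 := (tsub_pos_of_lt (by exact_mod_cast hC1)).ne'
    exact ENNReal.add_ne_top.2 ⟨ENNReal.mul_ne_top (ENNReal.inv_ne_top.2 this) hT, by simp⟩
  obtain ⟨ν, hν, hle⟩ := exists_T1_le_tsum hsum hstep
  have hlim : Tendsto (fun n ↦ T1 (μ n) ν) atTop (𝓝 0) := by
    refine tendsto_of_tendsto_of_tendsto_of_le_of_le tendsto_const_nhds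
      (ENNReal.tendsto_sum_nat_add _ hsum) (fun _ ↦ zero_le) fun n ↦ ?_
    simpa only [add_comm n] using hle n
  have hfin : ∀ n, T1 ν (μ n) ≠ ∞ := fun n ↦ by
    rw [T1_comm]
    refine ne_top_of_le_ne_top hsum ((hle n).trans ?_)
    exact ENNReal.tsum_comp_le_tsum_of_injective (add_right_injective n) _
  have hνP : MemP ν := (hμ 0).of_T1_ne_top (hfin 0)
  refine ⟨ν, hνP, (eq_of_T1_eq_zero (le_antisymm ?_ zero_le)).symm⟩
  -- Both `ν` and `conv ν m` are limits of the iterates, so their distance is zero.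
  have hbound : ∀ n, T1 ν (conv ν m) ≤ T1 (μ (n + 1)) ν + C * T1 (μ n) ν := by
    intro n
    refine (T1_triangle ν (μ (n + 1)) _).trans ?_
    rw [T1_comm ν]
    gcongr
    simp only [hμdef, conv_pow_succ]
    exact T1_conv_le hC (T1_ne_top (hμ n) hνP)
  refine ge_of_tendsto' (x := atTop) ?_ hbound
  simpa using ((tendsto_add_atTop_iff_nat 1).2 hlim).add
    (ENNReal.Tendsto.const_mul (a := (C : ℝ≥0∞)) hlim (Or.inr ENNReal.coe_ne_top))

omit [CompleteSpace X] in
/-- A measure attracting the walk from every starting point is the only invariant one, also among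
measures without first moment. -/
lemma eq_of_invariant {ν ν' : Measure X} [IsProbabilityMeasure ν] [IsProbabilityMeasure ν']
    (hprob : ∀ n x, IsProbabilityMeasure ((m ^ n) x))
    (hlim : ∀ x, Tendsto (fun n ↦ T1 ((m ^ n) x) ν) atTop (𝓝 0)) (h : conv ν' m = ν') :
    ν' = ν := by
  refine ext_of_lipschitz fun f L hf hf1 hL ↦ ?_
  have hconst : ∀ n, ∫⁻ x, ∫⁻ y, f y ∂((m ^ n) x) ∂ν' = ∫⁻ x, f x ∂ν' := fun n ↦ by
    rw [← lintegral_conv ν' hf, conv_pow_of_invariant h]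
  -- The averages of `f` after `n` steps tend pointwise to the constant `∫⁻ y, f y ∂ν`, while by
  -- `hconst` their integrals against `ν'` do not change.
  have ht : Tendsto (fun n ↦ ∫⁻ x, ∫⁻ y, f y ∂((m ^ n) x) ∂ν') atTop
      (𝓝 (∫⁻ _, ∫⁻ y, f y ∂ν ∂ν')) :=
    tendsto_lintegral_of_dominated_convergence (fun _ ↦ 1) (fun n ↦ hf.lintegral_kernel)
      (fun n ↦ .of_forall fun x ↦ (lintegral_mono hf1).trans (by simp)) (by simp)
      (.of_forall fun x ↦ tendsto_lintegral_of_tendsto_T1 (hlim x) hf hf1 hL)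
  simp only [hconst] at ht
  simpa using tendsto_nhds_unique tendsto_const_nhds ht

omit [CompleteSpace X] in
lemma jump_eq_toReal (x : X) :
    jump m x = (∫⁻ y, edist x y ∂(m x)).toReal := by
  rw [jump, integral_eq_lintegral_of_nonneg_ae (f := fun y ↦ dist x y)
    (.of_forall fun _ ↦ dist_nonneg)
    (measurable_const.dist measurable_id).aestronglyMeasurable]
  simp_rw [edist_dist]

/-- Going from `x` to `ν` through `m x` gives `T ≤ J + (1 - κ) T`, with `T` the distance sought and
`J` the jump at `x`; since `T` is finite it can be absorbed on the left. -/
lemma RicciGE.T1_dirac_le (hm : IsRandomWalk m) (h : RicciGE m κ) (hκ : 0 < κ) (hκ1 : κ ≤ 1)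
    {ν : Measure X} (hν : MemP ν) (hinv : conv ν m = ν) (x : X) :
    (T1 (Measure.dirac x) ν).toReal ≤ jump m x / κ := by
  have := hm.isMarkovKernel
  have := hν.1
  have hx := memP_dirac x
  have hT := T1_ne_top hx hν
  have hJ := (hm x).lintegral_edist_lt_top x
  have hc := T1_conv_le (h.T1_le hm) hT
  rw [conv_dirac, hinv] at hc
  have h₁ : T1 (Measure.dirac x) ν ≤
      ∫⁻ y, edist x y ∂(m x) + (1 - κ).toNNReal * T1 (Measure.dirac x) ν :=
    (T1_triangle _ (m x) _).trans (add_le_add (T1_dirac_left_le x _) hc)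
  have hfin : ((1 - κ).toNNReal : ℝ≥0∞) * T1 (Measure.dirac x) ν ≠ ∞ :=
    ENNReal.mul_ne_top ENNReal.coe_ne_top hT
  have h₂ := ENNReal.toReal_mono (ENNReal.add_ne_top.2 ⟨hJ.ne, hfin⟩) h₁
  rw [ENNReal.toReal_add hJ.ne hfin, ← jump_eq_toReal, ENNReal.toReal_mul, ENNReal.coe_toReal,
    Real.coe_toNNReal _ (sub_nonneg.2 hκ1)] at h₂
  rw [le_div_iff₀ hκ]
  linarith

end Invariant
end RicciWalk

/-! ### Equivalence, uniqueness and rates of convergence. -/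

theorem proposition20 {X : Type*} [MetricSpace X] [CompleteSpace X]
    [SecondCountableTopology X] [MeasurableSpace X] [BorelSpace X]
    (m : Kernel X X) (hm : RicciWalk.IsRandomWalk m) (κ : ℝ) :
    -- curvature at least `κ` is equivalent to `(1 - κ)`-contraction of `T1` on `𝒫(X)`
    (RicciWalk.RicciGE m κ ↔
      ∀ μ μ' : Measure X, RicciWalk.MemP μ → RicciWalk.MemP μ' →
        RicciWalk.T1 (RicciWalk.conv μ m) (RicciWalk.conv μ' m) ≠ ∞ ∧
        (RicciWalk.T1 (RicciWalk.conv μ m) (RicciWalk.conv μ' m)).toReal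
          ≤ (1 - κ) * (RicciWalk.T1 μ μ').toReal) ∧
    -- in this case `𝒫(X)` is preserved
    (RicciWalk.RicciGE m κ →
      ∀ μ : Measure X, RicciWalk.MemP μ → RicciWalk.MemP (RicciWalk.conv μ m)) ∧
    -- positive curvature: unique invariant distribution and exponential convergence; `m ^ n` is
    -- the `n`-step transition kernel (power for the composition of kernels)
    (Nonempty X → 0 < κ → RicciWalk.RicciGE m κ →
      ∃ ν : Measure X,
        RicciWalk.MemP ν ∧ RicciWalk.IsInvariantDistribution m ν ∧
        (∀ ν' : Measure X, RicciWalk.IsInvariantDistribution m ν' → ν' = ν) ∧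
        (∀ μ : Measure X, RicciWalk.MemP μ → ∀ n : ℕ,
          RicciWalk.T1 (RicciWalk.conv μ (m ^ n)) ν ≠ ∞ ∧
          (RicciWalk.T1 (RicciWalk.conv μ (m ^ n)) ν).toReal
            ≤ (1 - κ) ^ n * (RicciWalk.T1 μ ν).toReal) ∧
        (∀ (x : X) (n : ℕ),
          RicciWalk.T1 ((m ^ n) x) ν ≠ ∞ ∧
          (RicciWalk.T1 ((m ^ n) x) ν).toReal
            ≤ (1 - κ) ^ n * (RicciWalk.jump m x / κ))) := by
  have := hm.isMarkovKernel
  refine ⟨⟨fun h μ μ' hμ hμ' ↦ ?_, fun h ↦ RicciWalk.ricciGE_of_T1_conv_le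
    fun μ μ' hμ hμ' ↦ (h μ μ' hμ hμ').2⟩, fun h μ hμ ↦ hμ.conv hm (h.T1_le hm), fun hX hκ h ↦ ?_⟩
  · have := hμ.1
    have := hμ'.1
    simpa using h.toReal_T1_le hμ hμ' (n := 1)
      (by simpa using RicciWalk.T1_conv_le (h.T1_le hm) (RicciWalk.T1_ne_top hμ hμ'))
  have hC := h.T1_le hm
  have hC1 : (1 - κ).toNNReal < 1 := by
    rw [Real.toNNReal_lt_one]
    linarith
  obtain ⟨ν, hν, hinv⟩ := RicciWalk.exists_invariant hm hC hC1
  have := hν.1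
  have hconv : ∀ μ : Measure X, RicciWalk.MemP μ → ∀ n : ℕ,
      RicciWalk.T1 (RicciWalk.conv μ (m ^ n)) ν ≤ (1 - κ).toNNReal ^ n * RicciWalk.T1 μ ν := by
    intro μ hμ n
    have := RicciWalk.T1_conv_pow_le hm hC hμ hν n
    rwa [RicciWalk.conv_pow_of_invariant hinv] at this
  have hdirac : ∀ (x : X) (n : ℕ), RicciWalk.T1 ((m ^ n) x) ν ≤
      (1 - κ).toNNReal ^ n * RicciWalk.T1 (Measure.dirac x) ν := by
    intro x n
    simpa only [RicciWalk.conv_dirac] using hconv _ (RicciWalk.memP_dirac x) n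
  have hpow : ∀ (n : ℕ) (x : X), IsProbabilityMeasure ((m ^ n) x) := by
    intro n x
    have := ((RicciWalk.memP_dirac x).conv_pow hm hC n).1
    rwa [RicciWalk.conv_dirac] at this
  refine ⟨ν, hν, ⟨hν.1, hinv⟩, ?_, fun μ hμ n ↦ h.toReal_T1_le hμ hν (hconv μ hμ n), ?_⟩
  · rintro ν' ⟨hν', hinv'⟩
    refine RicciWalk.eq_of_invariant hpow (fun x ↦ ?_) hinv'
    refine tendsto_of_tendsto_of_tendsto_of_le_of_le tendsto_const_nhds ?_ (fun _ ↦ zero_le)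
      (hdirac x)
    simpa using ENNReal.Tendsto.mul_const
      (ENNReal.tendsto_pow_atTop_nhds_zero_of_lt_one (by exact_mod_cast hC1))
      (Or.inr (RicciWalk.T1_ne_top (RicciWalk.memP_dirac x) hν))
  · intro x n
    obtain ⟨htop, hle⟩ := h.toReal_T1_le (RicciWalk.memP_dirac x) hν (hdirac x n)
    refine ⟨htop, ?_⟩
    rcases le_or_gt κ 1 with hκ1 | hκ1
    · refine hle.trans (mul_le_mul_of_nonneg_left (h.T1_dirac_le hm hκ hκ1 hν hinv x) ?_)
      exact pow_nonneg (sub_nonneg.2 hκ1) n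
    -- Here `(1 - κ) ^ n` may be negative, but `X` is a single point and both sides vanish.
    · have := h.subsingleton hκ1
      have := hpow n x
      have hJ : RicciWalk.jump m x = 0 := by
        simp [RicciWalk.jump, Subsingleton.elim _ x]
      simp [RicciWalk.T1_eq_zero_of_subsingleton, hJ]
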